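/- Let $G$ be a compact metric graph, i.e. the space obtained from a finite connected graph $(V,E)$ (loops and multiple edges allowed) and edge lengths $\ell\colon E\to(0,\infty)$ by identifying each edge $e$ with $[0,\ell(e)]$ and gluing endpoints that correspond to the same vertex. Let $H^1(G)$ be the space of continuous $f\colon G\to\mathbb R$ with $f|_e\in H^1((0,\ell(e)))$ for every $e\in E$, and put $q(f,g)=\sum_{e\in E}\int_0^{\ell(e)}f'g'\,dx$. For a finite Borel measure $\mu$ on $G$, let $H^1(G,\mu)$ be the space of $f\in H^1(G)$ that are harmonic on $G\setminus\operatorname{supp}\mu$, i.e. $q(f,g)=0$ for all $g\in H^1(G)$ vanishing on $\operatorname{supp}\mu$; it embeds into the real space $L^2(G,\mu)$. Let $H_\mu$ be the operator in $L^2(G,\mu)$ given by: $f\in\operatorname{dom}(H_\mu)$ and $H_\mu f=g$ if and only if $f\in H^1(G,\mu)$ and $q(f,\varphi)=\int_G g\varphi\,d\mu$ for all $\varphi\in H^1(G,\mu)$. Let $\lambda_0(H_\mu)\le\lambda_1(H_\mu)\le\lambda_2(H_\mu)\le\cdots$ be the eigenvalues of $H_\mu$ counted with multiplicities, where $\lambda_k(H_\mu):=+\infty$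 if $k\ge\dim L^2(G,\mu)$. Let $\mathcal N$ be the set of Borel probability measures on $G$ with the weak-$*$ topology, and let $\widetilde{\mathcal N}\subset\mathcal N$ be a dense subset. Then $$\sup_{\mu\in\widetilde{\mathcal N}}\lambda_k(H_\mu)=+\infty\qquad\text{for all }k\ge1 .$$ -/

import Mathlib

open MeasureTheory Set
open scoped ContDiff ENNReal

universe u v

noncomputable section

namespace WeakDerivative

/-- `w` is a weak (distributional) derivative of `u` on the open interval `(0, l)`: integration by
parts holds against every test function `φ ∈ C_c^∞((0, l))`. -/
def IsWeakDeriv (l : ℝ) (u w : ℝ → ℝ) : Prop :=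
  ∀ φ : ℝ → ℝ, ContDiff ℝ ∞ φ → HasCompactSupport φ → tsupport φ ⊆ Ioo 0 l →
    ∫ x in Ioo 0 l, u x * deriv φ x = -∫ x in Ioo 0 l, w x * φ x

/-- `u` belongs to the Sobolev space `H¹((0, l))`: it is square integrable on `(0, l)` and has a
square integrable weak derivative there. -/
def MemH1 (l : ℝ) (u : ℝ → ℝ) : Prop :=
  MemLp u 2 (volume.restrict (Ioo 0 l)) ∧
    ∃ w : ℝ → ℝ, MemLp w 2 (volume.restrict (Ioo 0 l)) ∧ IsWeakDeriv l u w

open Classical in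
/-- The square integrable weak derivative of `u` on `(0, l)`, which is unique up to
a.e. equality; the value is `0` when `u` is not in `H¹((0, l))`. -/
def weakDeriv (l : ℝ) (u : ℝ → ℝ) : ℝ → ℝ :=
  if h : MemH1 l u then h.2.choose else 0

theorem MemH1.memLp_weakDeriv {l : ℝ} {u : ℝ → ℝ} (h : MemH1 l u) :
    MemLp (weakDeriv l u) 2 (volume.restrict (Ioo 0 l)) := by
  unfold weakDeriv
  rw [dif_pos h]
  exact h.2.choose_spec.1

theorem MemH1.isWeakDeriv {l : ℝ} {u : ℝ → ℝ} (h : MemH1 l u) :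
    IsWeakDeriv l u (weakDeriv l u) := by
  unfold weakDeriv
  rw [dif_pos h]
  exact h.2.choose_spec.2

theorem integrable_mul_test {l : ℝ} {u φ : ℝ → ℝ}
    (hu : MemLp u 2 (volume.restrict (Ioo 0 l))) (hφ : Continuous φ)
    (hc : HasCompactSupport φ) :
    Integrable (fun x => u x * φ x) (volume.restrict (Ioo 0 l)) :=
  have hφ2 : MemLp φ 2 (volume.restrict (Ioo 0 l)) :=
    (hφ.memLp_of_hasCompactSupport hc).mono_measure Measure.restrict_le_self
  hu.integrable_mul hφ2

theorem IsWeakDeriv.add {l : ℝ} {u₁ u₂ w₁ w₂ : ℝ → ℝ}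
    (hu₁ : MemLp u₁ 2 (volume.restrict (Ioo 0 l)))
    (hu₂ : MemLp u₂ 2 (volume.restrict (Ioo 0 l)))
    (hw₁ : MemLp w₁ 2 (volume.restrict (Ioo 0 l)))
    (hw₂ : MemLp w₂ 2 (volume.restrict (Ioo 0 l)))
    (h₁ : IsWeakDeriv l u₁ w₁) (h₂ : IsWeakDeriv l u₂ w₂) :
    IsWeakDeriv l (fun x => u₁ x + u₂ x) (fun x => w₁ x + w₂ x) := by
  intro φ hφ hc hs
  have hd : Continuous (deriv φ) := hφ.continuous_deriv (by simp)
  simp only [add_mul]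
  rw [integral_add (integrable_mul_test hu₁ hd hc.deriv) (integrable_mul_test hu₂ hd hc.deriv),
    integral_add (integrable_mul_test hw₁ hφ.continuous hc)
      (integrable_mul_test hw₂ hφ.continuous hc), h₁ φ hφ hc hs, h₂ φ hφ hc hs, neg_add]

theorem IsWeakDeriv.const_mul {l : ℝ} {u w : ℝ → ℝ} (c : ℝ) (h : IsWeakDeriv l u w) :
    IsWeakDeriv l (fun x => c * u x) (fun x => c * w x) := by
  intro φ hφ hc hs
  simp only [mul_assoc]
  rw [integral_const_mul, integral_const_mul, h φ hφ hc hs, mul_neg]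

theorem IsWeakDeriv.ae_unique {l : ℝ} {u w₁ w₂ : ℝ → ℝ}
    (hw₁ : MemLp w₁ 2 (volume.restrict (Ioo 0 l)))
    (hw₂ : MemLp w₂ 2 (volume.restrict (Ioo 0 l)))
    (h₁ : IsWeakDeriv l u w₁) (h₂ : IsWeakDeriv l u w₂) :
    w₁ =ᵐ[volume.restrict (Ioo 0 l)] w₂ := by
  have hi : IntegrableOn (fun x => w₁ x - w₂ x) (Ioo 0 l) volume :=
    (hw₁.integrable one_le_two).sub (hw₂.integrable one_le_two)
  have key := isOpen_Ioo.ae_eq_zero_of_integral_contDiff_smul_eq_zero (U := Ioo (0 : ℝ) l)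
    (f := fun x => w₁ x - w₂ x) (μ := volume) hi.locallyIntegrableOn (by
      intro φ hφ hc hs
      have e := (h₁ φ hφ hc hs).symm.trans (h₂ φ hφ hc hs)
      have hz : ∫ x in Ioo 0 l, (w₁ x - w₂ x) * φ x = 0 := by
        simp only [sub_mul]
        rw [integral_sub (integrable_mul_test hw₁ hφ.continuous hc)
          (integrable_mul_test hw₂ hφ.continuous hc)]
        linarith
      rw [← hz, ← setIntegral_eq_integral_of_forall_compl_eq_zero (s := Ioo (0 : ℝ) l)]
      · simp only [smul_eq_mul, mul_comm]
      · intro x hx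
        have : φ x = 0 := image_eq_zero_of_notMem_tsupport fun h => hx (hs h)
        simp [this])
  filter_upwards [(ae_restrict_iff' measurableSet_Ioo).mpr key] with x hx
  linarith

theorem MemH1.add {l : ℝ} {u₁ u₂ : ℝ → ℝ} (h₁ : MemH1 l u₁) (h₂ : MemH1 l u₂) :
    MemH1 l (fun x => u₁ x + u₂ x) :=
  ⟨h₁.1.add h₂.1, _, h₁.memLp_weakDeriv.add h₂.memLp_weakDeriv,
    h₁.isWeakDeriv.add h₁.1 h₂.1 h₁.memLp_weakDeriv h₂.memLp_weakDeriv h₂.isWeakDeriv⟩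

theorem MemH1.const_mul {l : ℝ} {u : ℝ → ℝ} (c : ℝ) (h : MemH1 l u) :
    MemH1 l (fun x => c * u x) :=
  ⟨h.1.const_mul c, _, h.memLp_weakDeriv.const_mul c, h.isWeakDeriv.const_mul c⟩

theorem weakDeriv_add {l : ℝ} {u₁ u₂ : ℝ → ℝ} (h₁ : MemH1 l u₁) (h₂ : MemH1 l u₂) :
    weakDeriv l (fun x => u₁ x + u₂ x) =ᵐ[volume.restrict (Ioo 0 l)]
      fun x => weakDeriv l u₁ x + weakDeriv l u₂ x :=
  (h₁.add h₂).isWeakDeriv.ae_unique (h₁.add h₂).memLp_weakDeriv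
    (h₁.memLp_weakDeriv.add h₂.memLp_weakDeriv)
    (h₁.isWeakDeriv.add h₁.1 h₂.1 h₁.memLp_weakDeriv h₂.memLp_weakDeriv h₂.isWeakDeriv)

theorem weakDeriv_const_mul {l : ℝ} {u : ℝ → ℝ} (c : ℝ) (h : MemH1 l u) :
    weakDeriv l (fun x => c * u x) =ᵐ[volume.restrict (Ioo 0 l)]
      fun x => c * weakDeriv l u x :=
  (h.const_mul c).isWeakDeriv.ae_unique (h.const_mul c).memLp_weakDeriv
    (h.memLp_weakDeriv.const_mul c) (h.isWeakDeriv.const_mul c)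

end WeakDerivative

open WeakDerivative

/-- A connected multigraph (loops and multiple edges allowed) with vertex set `V` and edge set `E`,
an orientation of its edges, and a positive finite length for every edge. The finiteness of `V`
and `E` is assumed through `Fintype` instances. -/
structure MetricGraph (V : Type u) (E : Type v) where
  source : E → V
  target : E → V
  length : E → ℝ
  length_pos : ∀ e, 0 < length e
  nonempty : Nonempty V
  connected : ∀ a b : V, Relation.EqvGen (fun x y => ∃ e, source e = x ∧ target e = y) a b

namespace MetricGraph

variable {V : Type u} {E : Type v} (G : MetricGraph V E)

/-- The disjoint union of the discrete set of vertices and of the intervals `[0, ℓ(e)]`. -/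
def Pieces : Type (max u v) := V ⊕ (Σ e : E, Icc (0 : ℝ) (G.length e))

instance : TopologicalSpace G.Pieces :=
  letI : TopologicalSpace V := ⊥
  inferInstanceAs (TopologicalSpace (V ⊕ (Σ e : E, Icc (0 : ℝ) (G.length e))))

/-- The gluing relation: the left endpoint of the interval of `e` is the initial vertex of `e`, the
right endpoint is its terminal vertex. -/
inductive Glue : G.Pieces → G.Pieces → Prop
  | source (e : E) :
      Glue (Sum.inr ⟨e, ⟨0, left_mem_Icc.2 (G.length_pos e).le⟩⟩) (Sum.inl (G.source e))
  | target (e : E) :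
      Glue (Sum.inr ⟨e, ⟨G.length e, right_mem_Icc.2 (G.length_pos e).le⟩⟩)
        (Sum.inl (G.target e))

/-- The metric graph as a topological space: the quotient of the pieces by the gluing, with the
quotient topology (which is the topology of the path metric). -/
def Space : Type (max u v) := Quot G.Glue

instance : TopologicalSpace G.Space := inferInstanceAs (TopologicalSpace (Quot G.Glue))

instance : MeasurableSpace G.Space := borel G.Space

instance : BorelSpace G.Space := ⟨rfl⟩

/-- The point of the metric graph at arc length `x` from the initial vertex of the edge `e`
(`x` is clamped to `[0, ℓ(e)]`). -/
def edgePoint (e : E) (x : ℝ) : G.Space :=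
  Quot.mk G.Glue (Sum.inr ⟨e, projIcc 0 (G.length e) (G.length_pos e).le x⟩)

/-- The Sobolev space `H¹(G)`: continuous functions whose restriction to every edge `e` belongs to
`H¹((0, ℓ(e)))`. -/
def H1 : Submodule ℝ C(G.Space, ℝ) where
  carrier := {f | ∀ e, MemH1 (G.length e) fun x => f (G.edgePoint e x)}
  zero_mem' := fun e => by
    refine ⟨by simp, 0, by simp, fun φ _ _ _ => by simp⟩
  add_mem' := fun hf hg e => (hf e).add (hg e)
  smul_mem' := fun c _ hf e => (hf e).const_mul c

/-- The derivative of `f` along the edge `e`, as a function of the arc length on `(0, ℓ(e))`. -/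
def edgeDeriv (f : C(G.Space, ℝ)) (e : E) : ℝ → ℝ :=
  weakDeriv (G.length e) fun x => f (G.edgePoint e x)

variable [Fintype E]

/-- The energy form `q(f, g) = ∫_G f' g' dx`. -/
def energy (f g : C(G.Space, ℝ)) : ℝ :=
  ∑ e, ∫ x in Ioo 0 (G.length e), G.edgeDeriv f e x * G.edgeDeriv g e x

theorem energy_add_left {f₁ f₂ g : C(G.Space, ℝ)} (h₁ : f₁ ∈ G.H1) (h₂ : f₂ ∈ G.H1)
    (hg : g ∈ G.H1) : G.energy (f₁ + f₂) g = G.energy f₁ g + G.energy f₂ g := by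
  unfold energy
  rw [← Finset.sum_add_distrib]
  refine Finset.sum_congr rfl fun e _ => ?_
  refine Eq.trans (integral_congr_ae ?_) (integral_add
    ((h₁ e).memLp_weakDeriv.integrable_mul (hg e).memLp_weakDeriv)
    ((h₂ e).memLp_weakDeriv.integrable_mul (hg e).memLp_weakDeriv))
  filter_upwards [weakDeriv_add (h₁ e) (h₂ e)] with x hx
  exact (congrArg (· * _) hx).trans (add_mul _ _ _)

theorem energy_smul_left (c : ℝ) {f : C(G.Space, ℝ)} (hf : f ∈ G.H1) (g : C(G.Space, ℝ)) :
    G.energy (c • f) g = c * G.energy f g := by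
  unfold energy
  rw [Finset.mul_sum]
  refine Finset.sum_congr rfl fun e _ => ?_
  rw [← integral_const_mul]
  refine integral_congr_ae ?_
  filter_upwards [weakDeriv_const_mul c (hf e)] with x hx
  rw [← mul_assoc]
  exact congrArg (· * _) hx

theorem energy_zero_left (g : C(G.Space, ℝ)) : G.energy 0 g = 0 := by
  simpa using G.energy_smul_left 0 G.H1.zero_mem g

/-- `f` is harmonic on the set `O`: `q(f, g) = 0` for every `g ∈ H¹(G)` which vanishes
outside `O`. -/
def IsHarmonicOn (f : C(G.Space, ℝ)) (O : Set G.Space) : Prop :=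
  ∀ g ∈ G.H1, (∀ x ∉ O, g x = 0) → G.energy f g = 0

/-- The form domain `H¹(G, μ)`: functions in `H¹(G)` which are harmonic off the support of `μ`. -/
def H1Harmonic (μ : Measure G.Space) : Submodule ℝ C(G.Space, ℝ) where
  carrier := {f | f ∈ G.H1 ∧ G.IsHarmonicOn f μ.supportᶜ}
  zero_mem' := ⟨G.H1.zero_mem, fun g _ _ => G.energy_zero_left g⟩
  add_mem' := fun {f₁ f₂} h₁ h₂ => ⟨G.H1.add_mem h₁.1 h₂.1, fun g hg h0 => by
    rw [G.energy_add_left h₁.1 h₂.1 hg, h₁.2 g hg h0, h₂.2 g hg h0, add_zero]⟩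
  smul_mem' := fun c f h => ⟨G.H1.smul_mem c h.1, fun g hg h0 => by
    rw [G.energy_smul_left c h.1, h.2 g hg h0, mul_zero]⟩

variable [Fintype V]

instance : CompactSpace G.Pieces :=
  letI : TopologicalSpace V := ⊥
  inferInstanceAs (CompactSpace (V ⊕ (Σ e : E, Icc (0 : ℝ) (G.length e))))

instance : CompactSpace G.Space := inferInstanceAs (CompactSpace (Quot G.Glue))

theorem integrable_Lp_mul (μ : Measure G.Space) [IsFiniteMeasure μ] (g : Lp ℝ 2 μ)
    (φ : C(G.Space, ℝ)) : Integrable (fun x => g x * φ x) μ :=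
  have hφ : MemLp φ 2 μ :=
    MemLp.of_bound φ.continuous.measurable.aestronglyMeasurable ‖φ‖
      (Filter.Eventually.of_forall φ.norm_coe_le_norm)
  (Lp.memLp g).integrable_mul hφ

/-- The Laplacian `H_μ` on `L²(G, μ)`, given through its graph: `(u, g)` lies in it, that is,
`u ∈ dom(H_μ)` and `H_μ u = g`, if and only if `u` is the class of some `f ∈ H¹(G, μ)` such that
`q(f, φ) = ∫_G g φ dμ` for all `φ ∈ H¹(G, μ)`. -/
def laplacianGraph (μ : Measure G.Space) [IsFiniteMeasure μ] :
    Submodule ℝ (Lp ℝ 2 μ × Lp ℝ 2 μ) where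
  carrier := {p | ∃ f ∈ G.H1Harmonic μ, p.1 =ᵐ[μ] f ∧
    ∀ φ ∈ G.H1Harmonic μ, G.energy f φ = ∫ x, p.2 x * φ x ∂μ}
  zero_mem' := by
    refine ⟨0, Submodule.zero_mem _, Lp.coeFn_zero _ _ _, fun φ _ => ?_⟩
    rw [G.energy_zero_left, eq_comm]
    refine integral_eq_zero_of_ae ?_
    filter_upwards [Lp.coeFn_zero ℝ 2 μ] with x hx
    exact (congrArg (· * _) hx).trans (zero_mul _)
  add_mem' := by
    rintro ⟨u₁, g₁⟩ ⟨u₂, g₂⟩ ⟨f₁, hf₁, hu₁, h₁⟩ ⟨f₂, hf₂, hu₂, h₂⟩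
    refine ⟨f₁ + f₂, Submodule.add_mem _ hf₁ hf₂, ?_, fun φ hφ => ?_⟩
    · filter_upwards [Lp.coeFn_add u₁ u₂, hu₁, hu₂] with x hx h1 h2
      exact hx.trans (congrArg₂ (· + ·) h1 h2)
    · rw [G.energy_add_left hf₁.1 hf₂.1 hφ.1, h₁ φ hφ, h₂ φ hφ]
      refine Eq.trans (integral_add (G.integrable_Lp_mul μ g₁ φ)
        (G.integrable_Lp_mul μ g₂ φ)).symm (integral_congr_ae ?_)
      filter_upwards [Lp.coeFn_add g₁ g₂] with x hx
      exact (add_mul _ _ _).symm.trans (congrArg (· * _) hx.symm)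
  smul_mem' := by
    rintro c ⟨u, g⟩ ⟨f, hf, hu, h⟩
    refine ⟨c • f, Submodule.smul_mem _ c hf, ?_, fun φ hφ => ?_⟩
    · filter_upwards [Lp.coeFn_smul c u, hu] with x hx h1
      exact hx.trans (congrArg (c * ·) h1)
    · rw [G.energy_smul_left c hf.1, h φ hφ, ← integral_const_mul]
      refine integral_congr_ae ?_
      filter_upwards [Lp.coeFn_smul c g] with x hx
      exact (mul_assoc _ _ _).symm.trans (congrArg (· * _) hx.symm)

/-- The eigenspace `ker(H_μ - t)`: all `u ∈ dom(H_μ)` with `H_μ u = t u`. -/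
def eigenspace (μ : Measure G.Space) [IsFiniteMeasure μ] (t : ℝ) : Submodule ℝ (Lp ℝ 2 μ) :=
  (G.laplacianGraph μ).comap (LinearMap.prod LinearMap.id (t • LinearMap.id))

/-- The eigenvalue `λ_k(H_μ) ∈ [0, ∞]`, where `λ_0 ≤ λ_1 ≤ ...` lists the eigenvalues of `H_μ`
counted with multiplicities: the least `t` such that the eigenspaces of the eigenvalues
`s ≤ t` together span at least `k + 1` dimensions, and `+∞` if there is no such `t`. -/
def eigenvalue (μ : Measure G.Space) [IsFiniteMeasure μ] (k : ℕ) : EReal :=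
  ⨅ (t : ℝ) (_ : ((k + 1 : ℕ) : Cardinal) ≤
    Module.rank ℝ (⨆ s ∈ Iic t, G.eigenspace μ s : Submodule ℝ (Lp ℝ 2 μ))), (t : EReal)

end MetricGraph

end

noncomputable section

namespace WeakDerivative

/-! Concentrating `μ` near a point `p₀` pushes up every eigenvalue except the lowest. By Morrey's
estimate (`IsWeakDeriv.sq_sub_le`) and connectedness, functions in `H¹(G)` vanishing at `p₀` satisfy
`f² ≤ D · q(f, f)` with a continuous weight `D`, `D p₀ = 0` (`exists_weight`). If the eigenvalues up
to `t` span two dimensions, some `f` in that spectral subspace vanishes at `p₀` and is nonzero in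
`L²(μ)`. Then `q(f, f) ≤ t ∫ f² dμ ≤ t (∫ D dμ) q(f, f)`, hence `1 ≤ t ∫ D dμ`
(`one_le_mul_integral_weight`). Since `∫ D dμ` is weak-* continuous in `μ` and vanishes at the Dirac
mass at `p₀`, a dense set of measures makes it arbitrarily small. -/

/-! ### Morrey's estimate on an interval -/

theorem sq_integral_mul_le {α : Type*} [MeasurableSpace α] {μ : Measure α} {f g : α → ℝ}
    (hf : MemLp f 2 μ) (hg : MemLp g 2 μ) :
    (∫ x, f x * g x ∂μ) ^ 2 ≤ (∫ x, f x ^ 2 ∂μ) * ∫ x, g x ^ 2 ∂μ := by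
  have key {f g : α → ℝ} (hf : MemLp f 2 μ) (hg : MemLp g 2 μ) :
      inner ℝ (hf.toLp f) (hg.toLp g) = ∫ x, f x * g x ∂μ := by
    rw [L2.inner_def]
    refine integral_congr_ae ?_
    filter_upwards [hf.coeFn_toLp, hg.coeFn_toLp] with x h1 h2
    simp [h1, h2, mul_comm]
  have h := real_inner_mul_inner_self_le (hf.toLp f) (hg.toLp g)
  rw [key hf hg, key hf hf, key hg hg] at h
  simpa only [sq] using h

-- Test the weak derivative against a mollified indicator of `[x, y]`: the derivative of the test
-- function is a difference of two bumps, which produces the two mollified values, and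
-- Cauchy–Schwarz bounds the other side.
open scoped Convolution in
theorem IsWeakDeriv.sq_sub_convolution_le {l : ℝ} {u w : ℝ → ℝ} (hu : Continuous u)
    (hw : MemLp w 2 (volume.restrict (Ioo 0 l))) (h : IsWeakDeriv l u w)
    (b : ContDiffBump (0 : ℝ)) {x y : ℝ} (hx : b.rOut < x) (hxy : x ≤ y) (hy : y + b.rOut < l) :
    ((b.normed volume ⋆[ContinuousLinearMap.lsmul ℝ ℝ, volume] u : ℝ → ℝ) x -
      (b.normed volume ⋆[ContinuousLinearMap.lsmul ℝ ℝ, volume] u : ℝ → ℝ) y) ^ 2 ≤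
      (y - x + 2 * b.rOut) * ∫ z in Ioo 0 l, w z ^ 2 := by
  set ρ : ℝ → ℝ := b.normed volume with hρ
  set r := b.rOut with hr
  have hr0 : 0 < r := b.rOut_pos
  have hρc : Continuous ρ := b.continuous_normed
  have hρi (a c : ℝ) : IntervalIntegrable ρ volume a c := hρc.intervalIntegrable a c
  have hρ0 (z : ℝ) (hz : z ≤ -r ∨ r ≤ z) : ρ z = 0 := by
    have : z ∉ Function.support ρ := by
      rw [hρ, b.support_normed_eq, Metric.mem_ball, dist_zero_right, Real.norm_eq_abs, not_lt]
      rcases hz with hz | hz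
      · exact (le_neg_of_le_neg hz).trans (neg_le_abs z)
      · exact hz.trans (le_abs_self z)
    simpa using this
  -- This is the convolution of `ρ` with the indicator of `[x, y]`.
  set φ : ℝ → ℝ := fun z => ∫ s in (z - y)..(z - x), ρ s with hφ
  have hφd (z : ℝ) : HasDerivAt φ (ρ (z - x) - ρ (z - y)) z := by
    have hF (c : ℝ) : HasDerivAt (fun z => ∫ s in (0 : ℝ)..z - c, ρ s) (ρ (z - c)) z := by
      have := (hρc.integral_hasStrictDerivAt 0 (z - c)).hasDerivAt
      exact this.comp_sub_const z c
    refine ((hF x).sub (hF y)).congr_of_eventuallyEq (.of_forall fun z => ?_)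
    exact (intervalIntegral.integral_interval_sub_left (hρi _ _) (hρi _ _)).symm
  have hφ' : deriv φ = fun z => ρ (z - x) - ρ (z - y) := funext fun z => (hφd z).deriv
  have hφs : ContDiff ℝ ∞ φ := by
    rw [contDiff_infty_iff_deriv, hφ']
    have hs : ContDiff ℝ ∞ ρ := b.contDiff_normed
    exact ⟨fun z => (hφd z).differentiableAt,
      (hs.comp (contDiff_id.sub contDiff_const)).sub (hs.comp (contDiff_id.sub contDiff_const))⟩
  have hφ0 (z : ℝ) (hz : z ∉ Icc (x - r) (y + r)) : φ z = 0 := by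
    refine intervalIntegral.integral_zero_ae (.of_forall fun s hs => hρ0 s ?_)
    rw [uIoc_of_le (by linarith)] at hs
    by_cases hzx : x - r ≤ z
    · right
      have : y + r < z := not_le.1 fun h' => hz ⟨hzx, h'⟩
      linarith [hs.1]
    · left
      linarith [hs.2]
  have hsub : Icc (x - r) (y + r) ⊆ Ioo 0 l := fun z hz =>
    ⟨by linarith [hz.1], by linarith [hz.2]⟩
  have hφc : HasCompactSupport φ := HasCompactSupport.intro isCompact_Icc hφ0
  have hts : tsupport φ ⊆ Ioo 0 l := by
    refine (closure_minimal (fun z hz => ?_) isClosed_Icc).trans hsub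
    by_contra h'
    exact hz (hφ0 z h')
  have hφnn (z : ℝ) : 0 ≤ φ z :=
    intervalIntegral.integral_nonneg (by linarith) fun s _ => b.nonneg_normed s
  have hφ1 (z : ℝ) : φ z ≤ 1 := by
    rw [hφ]
    simp only
    rw [intervalIntegral.integral_of_le (by linarith), ← b.integral_normed (μ := volume)]
    exact setIntegral_le_integral b.integrable_normed (.of_forall fun s => b.nonneg_normed s)
  have hconv (c : ℝ) : (ρ ⋆[ContinuousLinearMap.lsmul ℝ ℝ, volume] u : ℝ → ℝ) c =
      ∫ z, u z * ρ (z - c) := by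
    rw [convolution_eq_swap]
    refine integral_congr_ae (.of_forall fun z => ?_)
    simp only [ContinuousLinearMap.lsmul_apply, smul_eq_mul]
    rw [mul_comm, hρ, ← b.normed_neg (z - c), neg_sub]
  have hint (c : ℝ) : Integrable fun z => u z * ρ (z - c) := by
    refine Continuous.integrable_of_hasCompactSupport (by fun_prop) ?_
    exact (b.hasCompactSupport_normed.comp_homeomorph (Homeomorph.subRight c)).mul_left
  have hlhs : ∫ z in Ioo 0 l, u z * deriv φ z =
      (ρ ⋆[ContinuousLinearMap.lsmul ℝ ℝ, volume] u : ℝ → ℝ) x -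
      (ρ ⋆[ContinuousLinearMap.lsmul ℝ ℝ, volume] u : ℝ → ℝ) y := by
    rw [setIntegral_eq_integral_of_forall_compl_eq_zero, hconv, hconv,
      ← integral_sub (hint x) (hint y), hφ']
    · simp only [mul_sub]
    · intro z hz
      have : deriv φ z = 0 := by
        by_contra h'
        exact hz (hts (support_deriv_subset h'))
      rw [this, mul_zero]
  have hφL : MemLp φ 2 (volume.restrict (Ioo 0 l)) :=
    (hφs.continuous.memLp_of_hasCompactSupport hφc).mono_measure Measure.restrict_le_self
  have hφ2 : ∫ z in Ioo 0 l, φ z ^ 2 ≤ y - x + 2 * r := by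
    calc ∫ z in Ioo 0 l, φ z ^ 2
        ≤ ∫ z in Ioo 0 l, (Icc (x - r) (y + r)).indicator 1 z := by
          refine integral_mono hφL.integrable_sq
            (Integrable.indicator (integrable_const _) measurableSet_Icc) fun z => ?_
          by_cases hz : z ∈ Icc (x - r) (y + r)
          · simpa [indicator_of_mem hz, abs_of_nonneg (hφnn z)] using hφ1 z
          · simp [indicator_of_notMem hz, hφ0 z hz]
      _ = y - x + 2 * r := by
          rw [integral_indicator_one measurableSet_Icc, measureReal_restrict_apply
            measurableSet_Icc, inter_eq_left.2 hsub, Real.volume_real_Icc_of_le (by linarith)]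
          ring
  rw [← hlhs, h φ hφs hφc hts, neg_sq, mul_comm]
  exact (sq_integral_mul_le hw hφL).trans
    (mul_le_mul_of_nonneg_left hφ2 (integral_nonneg fun z => sq_nonneg _))

/-- One-dimensional Sobolev (Morrey) estimate. -/
theorem IsWeakDeriv.sq_sub_le {l : ℝ} {u w : ℝ → ℝ} (hl : 0 < l) (hu : Continuous u)
    (hw : MemLp w 2 (volume.restrict (Ioo 0 l))) (h : IsWeakDeriv l u w)
    {x y : ℝ} (hx : x ∈ Icc 0 l) (hy : y ∈ Icc 0 l) :
    (u x - u y) ^ 2 ≤ |x - y| * ∫ z in Ioo 0 l, w z ^ 2 := by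
  have key {x y : ℝ} (hx : 0 < x) (hxy : x ≤ y) (hy : y < l) :
      (u x - u y) ^ 2 ≤ |x - y| * ∫ z in Ioo 0 l, w z ^ 2 := by
    -- Bumps with radius tending to `0`; the mollifications converge pointwise because `u` is
    -- continuous.
    let b (n : ℕ) : ContDiffBump (0 : ℝ) :=
      ⟨1 / ((n : ℝ) + 1) / 2, 1 / ((n : ℝ) + 1), by positivity, half_lt_self (by positivity)⟩
    have hb : Filter.Tendsto (fun n => (b n).rOut) Filter.atTop (nhds 0) :=
      tendsto_one_div_add_atTop_nhds_zero_nat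
    have hc := ContDiffBump.convolution_tendsto_right_of_continuous (μ := volume) hb hu
    have hlim := (((tendsto_const_nhds (x := y - x)).add (hb.const_mul 2)).mul_const
      (∫ z in Ioo 0 l, w z ^ 2))
    rw [abs_sub_comm, abs_of_nonneg (sub_nonneg.2 hxy)]
    rw [mul_zero, add_zero] at hlim
    refine le_of_tendsto_of_tendsto (((hc x).sub (hc y)).pow 2) hlim ?_
    filter_upwards [hb.eventually (gt_mem_nhds hx),
      hb.eventually (gt_mem_nhds (sub_pos.2 hy))] with n h1 h2
    exact h.sq_sub_convolution_le hu hw (b n) h1 hxy (by linarith)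
  have key' : ∀ p ∈ Ioo 0 l ×ˢ Ioo 0 l,
      (u p.1 - u p.2) ^ 2 ≤ |p.1 - p.2| * ∫ z in Ioo 0 l, w z ^ 2 := by
    rintro ⟨x, y⟩ ⟨hx, hy⟩
    rcases le_total x y with hxy | hxy
    · exact key hx.1 hxy hy.2
    · rw [← neg_sq, neg_sub, abs_sub_comm]
      exact key hy.1 hxy hx.2
  -- The endpoints are reached by continuity of both sides.
  have hcl : (x, y) ∈ closure (Ioo 0 l ×ˢ Ioo 0 l) := by
    rw [closure_prod_eq, closure_Ioo hl.ne]
    exact ⟨hx, hy⟩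
  exact closure_minimal (t := {p : ℝ × ℝ | (u p.1 - u p.2) ^ 2 ≤
    |p.1 - p.2| * ∫ z in Ioo 0 l, w z ^ 2}) key' (isClosed_le (by fun_prop) (by fun_prop)) hcl

end WeakDerivative

namespace MetricGraph

variable {V : Type u} {E : Type v} (G : MetricGraph V E)

/-! ### Points of the graph and tent functions -/

/-- The point of the metric graph given by a vertex. -/
def vertexPoint (a : V) : G.Space := Quot.mk G.Glue (Sum.inl a)

theorem edgePoint_zero (e : E) : G.edgePoint e 0 = G.vertexPoint (G.source e) := by
  unfold edgePoint
  rw [projIcc_left]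
  exact Quot.sound (Glue.source e)

theorem edgePoint_length (e : E) : G.edgePoint e (G.length e) = G.vertexPoint (G.target e) := by
  unfold edgePoint
  rw [projIcc_right]
  exact Quot.sound (Glue.target e)

theorem continuous_edgePoint (e : E) : Continuous (G.edgePoint e) := by
  let _ : TopologicalSpace V := ⊥
  have h : Continuous fun y : Icc (0 : ℝ) (G.length e) =>
      (Sum.inr ⟨e, y⟩ : V ⊕ (Σ e : E, Icc (0 : ℝ) (G.length e))) :=
    continuous_inr.comp continuous_sigmaMk
  have h' : Continuous fun x => (show G.Pieces from
      Sum.inr ⟨e, projIcc 0 (G.length e) (G.length_pos e).le x⟩) := h.comp continuous_projIcc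
  exact continuous_quot_mk.comp h'

theorem exists_eq_point (p : G.Space) :
    (∃ a, p = G.vertexPoint a) ∨ ∃ e, ∃ y ∈ Icc 0 (G.length e), p = G.edgePoint e y := by
  induction p using Quot.ind with
  | mk q =>
    rcases q with a | ⟨e, y⟩
    · exact .inl ⟨a, rfl⟩
    · exact .inr ⟨e, y, y.2, by simp only [edgePoint, projIcc_val]; rfl⟩

/-- A continuous function on the metric graph that vanishes at the midpoint of the edge `e`, equals
`c * |y - ℓ(e) / 2|` at arc length `y` on `e`, and is constant on the rest of the graph. -/
theorem exists_tent (e : E) (c : ℝ) : ∃ D : C(G.Space, ℝ),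
    (∀ y ∈ Icc 0 (G.length e), D (G.edgePoint e y) = c * |y - G.length e / 2|) ∧
    (∀ a, D (G.vertexPoint a) = c * (G.length e / 2)) ∧
    ∀ e' ≠ e, ∀ y, D (G.edgePoint e' y) = c * (G.length e / 2) := by
  classical
  let _ : TopologicalSpace V := ⊥
  have : DiscreteTopology V := ⟨rfl⟩
  let F : V ⊕ (Σ e : E, Icc (0 : ℝ) (G.length e)) → ℝ :=
    Sum.elim (fun _ => c * (G.length e / 2)) fun p =>
      if p.1 = e then c * |(p.2 : ℝ) - G.length e / 2| else c * (G.length e / 2)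
  have hF : Continuous F := by
    refine continuous_const.sumElim (continuous_sigma fun e' => ?_)
    by_cases h : e' = e
    · simp only [h, if_true]
      fun_prop
    · simp only [h, if_false]
      fun_prop
  have hl := G.length_pos e
  -- Centring the tent at the midpoint gives both ends of `e` the same height, so it descends to the
  -- quotient even if `e` is a loop.
  have hG (a b : G.Pieces) (h : G.Glue a b) : F a = F b := by
    cases h with
    | source e' =>
      by_cases h : e' = e
      · simp [F, h, abs_of_pos (half_pos hl)]
      · simp [F, h]
    | target e' =>
      by_cases h : e' = e
      · subst h
        simp [F, sub_half, abs_of_pos (half_pos hl)]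
      · simp [F, h]
  let D : C(G.Space, ℝ) := ⟨Quot.lift F hG, continuous_quot_lift hG hF⟩
  refine ⟨D, fun y hy => ?_, fun a => rfl, fun e' he y => ?_⟩
  · change F (Sum.inr ⟨e, _⟩) = _
    simp [F, projIcc_of_mem _ hy]
  · change F (Sum.inr ⟨e', _⟩) = _
    simp [F, he]

/-! ### Energy controls oscillation -/

variable [Fintype E]

theorem energy_comm (f g : C(G.Space, ℝ)) : G.energy f g = G.energy g f := by
  simp only [energy, mul_comm]

theorem integral_edgeDeriv_sq_le_energy (f : C(G.Space, ℝ)) (e : E) :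
    ∫ x in Ioo 0 (G.length e), G.edgeDeriv f e x ^ 2 ≤ G.energy f f := by
  simp only [energy, ← sq]
  exact Finset.single_le_sum
    (f := fun e => ∫ x in Ioo 0 (G.length e), G.edgeDeriv f e x ^ 2)
    (fun e _ => integral_nonneg fun x => sq_nonneg _) (Finset.mem_univ e)

theorem energy_self_nonneg (f : C(G.Space, ℝ)) : 0 ≤ G.energy f f := by
  simp only [energy, ← sq]
  exact Finset.sum_nonneg fun e _ => integral_nonneg fun x => sq_nonneg _

theorem sq_sub_edgePoint_le {f : C(G.Space, ℝ)} (hf : f ∈ G.H1) (e : E) {x y : ℝ}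
    (hx : x ∈ Icc 0 (G.length e)) (hy : y ∈ Icc 0 (G.length e)) :
    (f (G.edgePoint e x) - f (G.edgePoint e y)) ^ 2 ≤ |x - y| * G.energy f f :=
  ((hf e).isWeakDeriv.sq_sub_le (G.length_pos e) (f.continuous.comp (G.continuous_edgePoint e))
    (hf e).memLp_weakDeriv hx hy).trans
    (mul_le_mul_of_nonneg_left (G.integral_edgeDeriv_sq_le_energy f e) (abs_nonneg _))

theorem abs_sub_edgePoint_le {f : C(G.Space, ℝ)} (hf : f ∈ G.H1) (e : E) {x y : ℝ}
    (hx : x ∈ Icc 0 (G.length e)) (hy : y ∈ Icc 0 (G.length e)) :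
    |f (G.edgePoint e x) - f (G.edgePoint e y)| ≤ √(G.length e) * √(G.energy f f) := by
  rw [← Real.sqrt_mul (G.length_pos e).le]
  refine Real.abs_le_sqrt ((G.sq_sub_edgePoint_le hf e hx hy).trans ?_)
  refine mul_le_mul_of_nonneg_right ?_ (G.energy_self_nonneg f)
  rw [abs_le]
  constructor <;> linarith [hx.1, hx.2, hy.1, hy.2]

/-- The edge estimate is chained along a path given by connectedness; the constant depends on the
path only, not on `f`. -/
theorem exists_abs_sub_vertexPoint_le (a b : V) : ∃ C : ℝ, 0 ≤ C ∧ ∀ f ∈ G.H1,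
    |f (G.vertexPoint a) - f (G.vertexPoint b)| ≤ C * √(G.energy f f) := by
  induction G.connected a b with
  | rel a b h =>
    obtain ⟨e, rfl, rfl⟩ := h
    refine ⟨√(G.length e), Real.sqrt_nonneg _, fun f hf => ?_⟩
    rw [← edgePoint_zero, ← edgePoint_length]
    exact G.abs_sub_edgePoint_le hf e (left_mem_Icc.2 (G.length_pos e).le)
      (right_mem_Icc.2 (G.length_pos e).le)
  | refl a => exact ⟨0, le_rfl, fun f _ => by simp⟩
  | symm a b _ ih =>
    obtain ⟨C, hC, h⟩ := ih
    exact ⟨C, hC, fun f hf => by rw [abs_sub_comm]; exact h f hf⟩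
  | trans a b c _ _ ih₁ ih₂ =>
    obtain ⟨C₁, hC₁, h₁⟩ := ih₁
    obtain ⟨C₂, hC₂, h₂⟩ := ih₂
    refine ⟨C₁ + C₂, add_nonneg hC₁ hC₂, fun f hf => (abs_sub_le _ (f (G.vertexPoint b)) _).trans ?_⟩
    rw [add_mul]
    exact add_le_add (h₁ f hf) (h₂ f hf)

theorem energy_sum_left {ι : Type*} (s : Finset ι) (f : ι → C(G.Space, ℝ))
    (hf : ∀ i ∈ s, f i ∈ G.H1) {g : C(G.Space, ℝ)} (hg : g ∈ G.H1) :
    G.energy (∑ i ∈ s, f i) g = ∑ i ∈ s, G.energy (f i) g := by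
  classical
  induction s using Finset.induction_on with
  | empty => simp [energy_zero_left]
  | insert i s hi ih =>
    have hs : ∀ j ∈ s, f j ∈ G.H1 := fun j hj => hf j (Finset.mem_insert_of_mem hj)
    rw [Finset.sum_insert hi, Finset.sum_insert hi,
      G.energy_add_left (hf i (Finset.mem_insert_self i s)) (G.H1.sum_mem hs) hg, ih hs]

variable [Fintype V]

theorem exists_abs_sub_le : ∃ C : ℝ, 0 ≤ C ∧ ∀ f ∈ G.H1, ∀ p q : G.Space,
    |f p - f q| ≤ C * √(G.energy f f) := by
  obtain ⟨a₀⟩ := G.nonempty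
  choose C hC0 hC using fun a => G.exists_abs_sub_vertexPoint_le a a₀
  set A := ∑ a, C a
  set B := ∑ e, √(G.length e)
  have hA0 : 0 ≤ A := Finset.sum_nonneg fun a _ => hC0 a
  have hB0 : 0 ≤ B := Finset.sum_nonneg fun e _ => Real.sqrt_nonneg _
  have hA (a : V) : C a ≤ A := Finset.single_le_sum (fun a _ => hC0 a) (Finset.mem_univ a)
  have hB (e : E) : √(G.length e) ≤ B :=
    Finset.single_le_sum (f := fun e => √(G.length e)) (fun e _ => Real.sqrt_nonneg _)
      (Finset.mem_univ e)
  have key (f) (hf : f ∈ G.H1) (p : G.Space) :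
      |f p - f (G.vertexPoint a₀)| ≤ (A + B) * √(G.energy f f) := by
    have hq := Real.sqrt_nonneg (G.energy f f)
    have hvert (a : V) : |f (G.vertexPoint a) - f (G.vertexPoint a₀)| ≤ A * √(G.energy f f) :=
      (hC a f hf).trans (mul_le_mul_of_nonneg_right (hA a) hq)
    rw [add_mul]
    rcases G.exists_eq_point p with ⟨a, rfl⟩ | ⟨e, y, hy, rfl⟩
    · exact (hvert a).trans (le_add_of_nonneg_right (mul_nonneg hB0 hq))
    · have h1 := (G.abs_sub_edgePoint_le hf e hy (left_mem_Icc.2 (G.length_pos e).le)).trans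
        (mul_le_mul_of_nonneg_right (hB e) hq)
      rw [edgePoint_zero] at h1
      refine (abs_sub_le _ (f (G.vertexPoint (G.source e))) _).trans ?_
      rw [add_comm]
      exact add_le_add (hvert _) h1
  refine ⟨(A + B) + (A + B), by positivity, fun f hf p q => ?_⟩
  refine (abs_sub_le _ (f (G.vertexPoint a₀)) _).trans ?_
  rw [add_mul, abs_sub_comm _ (f q)]
  exact add_le_add (key f hf p) (key f hf q)

/-- At a suitable point `p₀`, the values of the functions in `H¹(G)` vanishing at `p₀` are
controlled by their energy, with a continuous weight that vanishes at `p₀`. -/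
theorem exists_weight : ∃ (p₀ : G.Space) (D : C(G.Space, ℝ)), D p₀ = 0 ∧
    ∀ f ∈ G.H1, f p₀ = 0 → ∀ p, f p ^ 2 ≤ D p * G.energy f f := by
  obtain ⟨C, hC0, hC⟩ := G.exists_abs_sub_le
  -- Without edges the energy is zero, so the oscillation bound makes `f` constant and `D = 0`
  -- works.
  rcases isEmpty_or_nonempty E with hE | ⟨⟨e⟩⟩
  · obtain ⟨a₀⟩ := G.nonempty
    refine ⟨G.vertexPoint a₀, 0, rfl, fun f hf h0 p => ?_⟩
    have := hC f hf p (G.vertexPoint a₀)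
    have hz : G.energy f f = 0 := by simp [energy]
    rw [hz, h0, Real.sqrt_zero, mul_zero, sub_zero] at this
    simp [abs_nonpos_iff.1 this]
  have hl := G.length_pos e
  -- The slope `c ≥ 1` lets the tent dominate Morrey's bound on `e`; its height `c * ℓ(e) / 2 ≥ C ^
  -- 2` dominates the global bound elsewhere.
  set c := 1 + C ^ 2 / (G.length e / 2) with hc
  have hc1 : 1 ≤ c := le_add_of_nonneg_right (by positivity)
  have hcC : C ^ 2 ≤ c * (G.length e / 2) := by
    rw [hc, add_mul, div_mul_cancel₀ _ (by positivity)]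
    linarith
  have hm : G.length e / 2 ∈ Icc 0 (G.length e) := ⟨by linarith, by linarith⟩
  obtain ⟨D, hD, hDv, hDe⟩ := G.exists_tent e c
  refine ⟨G.edgePoint e (G.length e / 2), D, by simp [hD _ hm], fun f hf h0 p => ?_⟩
  have hq := G.energy_self_nonneg f
  have hglob (p) : f p ^ 2 ≤ c * (G.length e / 2) * G.energy f f := by
    have h := hC f hf p (G.edgePoint e (G.length e / 2))
    rw [h0, sub_zero] at h
    calc f p ^ 2 = |f p| ^ 2 := (sq_abs _).symm
      _ ≤ (C * √(G.energy f f)) ^ 2 := pow_le_pow_left₀ (abs_nonneg _) h 2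
      _ = C ^ 2 * G.energy f f := by rw [mul_pow, Real.sq_sqrt hq]
      _ ≤ _ := mul_le_mul_of_nonneg_right hcC hq
  rcases G.exists_eq_point p with ⟨a, rfl⟩ | ⟨e', y, hy, rfl⟩
  · rw [hDv]
    exact hglob _
  · by_cases he : e' = e
    · subst he
      rw [hD y hy]
      have h := G.sq_sub_edgePoint_le hf e' hy hm
      rw [h0, sub_zero] at h
      exact h.trans (mul_le_mul_of_nonneg_right
        (le_mul_of_one_le_left (abs_nonneg _) hc1) hq)
    · rw [hDe e' he]
      exact hglob _

/-! ### Spectral subspaces of continuous eigenfunctions -/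

theorem integrable_continuousMap (μ : Measure G.Space) [IsFiniteMeasure μ] (f : C(G.Space, ℝ)) :
    Integrable f μ :=
  (MemLp.of_bound f.continuous.measurable.aestronglyMeasurable ‖f‖
    (Filter.Eventually.of_forall f.norm_coe_le_norm) : MemLp f 1 μ).integrable le_rfl

theorem integrable_mul_continuousMap (μ : Measure G.Space) [IsFiniteMeasure μ]
    (f g : C(G.Space, ℝ)) : Integrable (fun x => f x * g x) μ :=
  G.integrable_continuousMap μ (f * g)

/-- The continuous representatives in `H¹(G, μ)` of the elements of `ker(H_μ - s)`. -/
def eigenfunctions (μ : Measure G.Space) [IsFiniteMeasure μ] (s : ℝ) :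
    Submodule ℝ C(G.Space, ℝ) where
  carrier := {f | f ∈ G.H1Harmonic μ ∧
    ∀ φ ∈ G.H1Harmonic μ, G.energy f φ = s * ∫ x, f x * φ x ∂μ}
  zero_mem' := ⟨Submodule.zero_mem _, fun φ _ => by simp [energy_zero_left]⟩
  add_mem' := fun {f₁ f₂} h₁ h₂ => ⟨Submodule.add_mem _ h₁.1 h₂.1, fun φ hφ => by
    rw [G.energy_add_left h₁.1.1 h₂.1.1 hφ.1, h₁.2 φ hφ, h₂.2 φ hφ, ← mul_add,
      ← integral_add (G.integrable_mul_continuousMap μ f₁ φ)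
        (G.integrable_mul_continuousMap μ f₂ φ)]
    simp only [ContinuousMap.add_apply, add_mul]⟩
  smul_mem' := fun c f h => ⟨Submodule.smul_mem _ c h.1, fun φ hφ => by
    rw [G.energy_smul_left c h.1.1, h.2 φ hφ, mul_left_comm, ← integral_const_mul]
    simp only [ContinuousMap.smul_apply, smul_eq_mul, mul_assoc]⟩

/-- Lifts eigenvectors to continuous functions, since evaluation at a point makes no sense on `L²`
classes. -/
theorem eigenspace_le_map_eigenfunctions (μ : Measure G.Space) [IsFiniteMeasure μ] (s : ℝ) :
    G.eigenspace μ s ≤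
      (G.eigenfunctions μ s).map (ContinuousMap.toLp 2 μ ℝ).toLinearMap := by
  rintro u ⟨f, hf, hu, h⟩
  replace hu : u =ᵐ[μ] f := hu
  refine ⟨f, ⟨hf, fun φ hφ => ?_⟩, Lp.ext ((ContinuousMap.coeFn_toLp μ f).trans hu.symm)⟩
  rw [h φ hφ, ← integral_const_mul]
  refine integral_congr_ae ?_
  filter_upwards [Lp.coeFn_smul s u, hu] with x hx hux
  change (s • u : Lp ℝ 2 μ) x * φ x = _
  rw [hx, Pi.smul_apply, hux, smul_eq_mul, mul_assoc]

/-- By symmetry, `q(f, g)` equals both `s ∫ f g dμ` and `r ∫ f g dμ`. -/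
theorem integral_mul_eigenfunctions_eq_zero {μ : Measure G.Space} [IsFiniteMeasure μ] {s r : ℝ}
    (hsr : s ≠ r) {f g : C(G.Space, ℝ)} (hf : f ∈ G.eigenfunctions μ s)
    (hg : g ∈ G.eigenfunctions μ r) : ∫ x, f x * g x ∂μ = 0 := by
  have h := G.energy_comm f g
  rw [hf.2 g hg.1, hg.2 f hf.1, ← sub_eq_zero] at h
  simp only [mul_comm (g _)] at h
  rw [← sub_mul] at h
  exact (mul_eq_zero.1 h).resolve_left (sub_ne_zero.2 hsr)

/-- Write `f` as a finite sum of eigenfunctions for distinct values `s ≤ t`. Orthogonality removes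
the cross terms in both the energy and the norm, leaving a termwise comparison. -/
theorem energy_self_le_of_mem_iSup_eigenfunctions {μ : Measure G.Space} [IsFiniteMeasure μ]
    {t : ℝ} {f : C(G.Space, ℝ)} (hf : f ∈ ⨆ s ∈ Iic t, G.eigenfunctions μ s) :
    f ∈ G.H1 ∧ G.energy f f ≤ t * ∫ x, f x ^ 2 ∂μ := by
  have hH : f ∈ G.H1Harmonic μ :=
    iSup₂_le (a := G.H1Harmonic μ) (fun s _ g hg => hg.1) hf
  rw [iSup_subtype', Submodule.mem_iSup_iff_exists_finsupp] at hf
  obtain ⟨F, hF, hsum⟩ := hf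
  rw [Finsupp.sum] at hsum
  have hdiag (s : Iic t) : ∫ x, F s x * f x ∂μ = ∫ x, F s x ^ 2 ∂μ := by
    have h (x : G.Space) : F s x * f x = ∑ r ∈ F.support, F s x * F r x := by
      rw [← hsum, ContinuousMap.sum_apply, Finset.mul_sum]
    simp only [h]
    rw [integral_finsetSum _ fun r _ => G.integrable_mul_continuousMap μ (F s) (F r),
      Finset.sum_eq_single s]
    · simp only [sq]
    · exact fun r _ hr => G.integral_mul_eigenfunctions_eq_zero
        (fun h => hr (Subtype.ext h.symm)) (hF s) (hF r)
    · intro hs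
      simp [Finsupp.notMem_support_iff.1 hs]
  have hsq : ∫ x, f x ^ 2 ∂μ = ∑ s ∈ F.support, ∫ x, F s x ^ 2 ∂μ := by
    have h (x : G.Space) : f x ^ 2 = ∑ s ∈ F.support, F s x * f x := by
      rw [← Finset.sum_mul, sq, ← ContinuousMap.sum_apply, hsum]
    simp only [h]
    rw [integral_finsetSum _ fun s _ => G.integrable_mul_continuousMap μ (F s) f]
    exact Finset.sum_congr rfl fun s _ => hdiag s
  have hen : G.energy f f = ∑ s ∈ F.support, (s : ℝ) * ∫ x, F s x ^ 2 ∂μ := by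
    have h := G.energy_sum_left F.support F (fun s _ => (hF s).1.1) hH.1
    rw [hsum] at h
    rw [h]
    exact Finset.sum_congr rfl fun s _ => by rw [(hF s).2 f hH, hdiag]
  refine ⟨hH.1, ?_⟩
  rw [hen, hsq, Finset.mul_sum]
  exact Finset.sum_le_sum fun s _ =>
    mul_le_mul_of_nonneg_right s.2 (integral_nonneg fun x => sq_nonneg _)

/-- If the eigenvalues up to `t` span at least two dimensions, then some nonzero function in the
corresponding spectral subspace vanishes at a given point. -/
theorem exists_mem_iSup_eigenfunctions_eq_zero {μ : Measure G.Space} [IsFiniteMeasure μ] {t : ℝ}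
    (h : 1 < Module.rank ℝ (⨆ s ∈ Iic t, G.eigenspace μ s : Submodule ℝ (Lp ℝ 2 μ)))
    (p : G.Space) : ∃ f ∈ ⨆ s ∈ Iic t, G.eigenfunctions μ s, f p = 0 ∧
      ContinuousMap.toLp 2 μ ℝ f ≠ 0 := by
  set T := ContinuousMap.toLp (E := ℝ) 2 μ ℝ
  set W := ⨆ s ∈ Iic t, G.eigenfunctions μ s
  have hW : (⨆ s ∈ Iic t, G.eigenspace μ s) ≤ W.map T.toLinearMap := by
    simp only [W, Submodule.map_iSup]
    exact iSup₂_mono fun s _ => G.eigenspace_le_map_eigenfunctions μ s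
  -- Otherwise evaluation at `p` has its kernel in `W` killed by `T`, so the image of `W` is at most
  -- one-dimensional.
  by_contra! H
  suffices hv : ∃ v, W.map T.toLinearMap ≤ Submodule.span ℝ {v} by
    obtain ⟨v, hv⟩ := hv
    refine h.not_ge ((Submodule.rank_mono (hW.trans hv)).trans ?_)
    simpa using rank_span_le (R := ℝ) {v}
  by_cases hp : ∃ f ∈ W, f p ≠ 0
  · obtain ⟨f, hf, hfp⟩ := hp
    refine ⟨T f, ?_⟩
    rintro _ ⟨g, hg, rfl⟩
    rw [Submodule.mem_span_singleton]
    refine ⟨g p / f p, ?_⟩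
    have h0 := H (g - (g p / f p) • f) (W.sub_mem hg (W.smul_mem _ hf))
      (by simp [div_mul_cancel₀ _ hfp])
    rw [map_sub, map_smul, sub_eq_zero] at h0
    exact h0.symm
  · push Not at hp
    refine ⟨0, ?_⟩
    rintro _ ⟨g, hg, rfl⟩
    rw [Submodule.mem_span_singleton]
    exact ⟨0, by simpa using (H g hg (hp g hg)).symm⟩

/-! ### Lower bound for the eigenvalues and conclusion -/

theorem one_le_mul_integral_weight {μ : Measure G.Space} [IsFiniteMeasure μ] {t : ℝ}
    (h : 1 < Module.rank ℝ (⨆ s ∈ Iic t, G.eigenspace μ s : Submodule ℝ (Lp ℝ 2 μ)))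
    {p₀ : G.Space} {D : C(G.Space, ℝ)}
    (hD : ∀ f ∈ G.H1, f p₀ = 0 → ∀ p, f p ^ 2 ≤ D p * G.energy f f) :
    0 < ∫ x, D x ∂μ ∧ 1 ≤ t * ∫ x, D x ∂μ := by
  obtain ⟨f, hfW, hf0, hfne⟩ := G.exists_mem_iSup_eigenfunctions_eq_zero h p₀
  obtain ⟨hf, hle⟩ := G.energy_self_le_of_mem_iSup_eigenfunctions hfW
  have hint : Integrable (fun x => f x ^ 2) μ := G.integrable_continuousMap μ (f ^ 2)
  have hpos : 0 < ∫ x, f x ^ 2 ∂μ := by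
    refine lt_of_le_of_ne (integral_nonneg fun x => sq_nonneg _) fun h0 => hfne ?_
    rw [eq_comm, integral_eq_zero_iff_of_nonneg (fun x => sq_nonneg _) hint] at h0
    refine Lp.ext ?_
    filter_upwards [ContinuousMap.coeFn_toLp (p := 2) (𝕜 := ℝ) μ f, Lp.coeFn_zero ℝ 2 μ, h0]
      with x h1 h2 h3
    rw [h1, h2]
    simpa using h3
  have hup : ∫ x, f x ^ 2 ∂μ ≤ (∫ x, D x ∂μ) * G.energy f f := by
    rw [← integral_mul_const]
    exact integral_mono hint ((G.integrable_continuousMap μ D).mul_const _) (hD f hf hf0)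
  have hq : 0 < G.energy f f := by
    refine lt_of_le_of_ne (G.energy_self_nonneg f) fun h0 => ?_
    rw [← h0, mul_zero] at hup
    exact hpos.not_ge hup
  have hDpos : 0 < ∫ x, D x ∂μ := (pos_iff_pos_of_mul_pos (hpos.trans_le hup)).2 hq
  refine ⟨hDpos, ?_⟩
  by_contra! hlt
  nlinarith

theorem le_eigenvalue {μ : Measure G.Space} [IsFiniteMeasure μ] {k : ℕ} (hk : 1 ≤ k)
    {p₀ : G.Space} {D : C(G.Space, ℝ)}
    (hD : ∀ f ∈ G.H1, f p₀ = 0 → ∀ p, f p ^ 2 ≤ D p * G.energy f f)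
    {N : ℝ} (hμ : N * ∫ x, D x ∂μ < 1) :
    (N : EReal) ≤ G.eigenvalue μ k := by
  refine le_iInf₂ fun t ht => EReal.coe_le_coe_iff.2 ?_
  -- Here `1 ≤ k` enters: rank at least `k + 1` leaves room for a function vanishing at `p₀`.
  have h1 : 1 < Module.rank ℝ (⨆ s ∈ Iic t, G.eigenspace μ s : Submodule ℝ (Lp ℝ 2 μ)) := by
    refine lt_of_lt_of_le ?_ ht
    exact_mod_cast Nat.lt_succ_of_le hk
  obtain ⟨hpos, hone⟩ := G.one_le_mul_integral_weight h1 hD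
  by_contra! hlt
  nlinarith

end MetricGraph

end

theorem mainTheorem9 {V : Type u} {E : Type v} [Fintype V] [Fintype E] (G : MetricGraph V E)
    (S : Set (ProbabilityMeasure G.Space)) (hS : Dense S) (k : ℕ) (hk : 1 ≤ k) :
    ⨆ μ ∈ S, G.eigenvalue (μ : Measure G.Space) k = ⊤ := by
  obtain ⟨p₀, D, hD0, hD⟩ := G.exists_weight
  rw [EReal.eq_top_iff_forall_lt]
  intro N
  -- Strictly above `N`, and positive so that `M⁻¹` is a usable threshold.
  set M : ℝ := |N| + 1
  have hM : 0 < M := by positivity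
  let D' := BoundedContinuousFunction.mkOfCompact D
  have hopen : IsOpen {μ : ProbabilityMeasure G.Space | ∫ x, D' x ∂(μ : Measure G.Space) < M⁻¹} :=
    isOpen_lt (ProbabilityMeasure.continuous_integral_boundedContinuousFunction D')
      continuous_const
  obtain ⟨μ, hμ, hμS⟩ := hS.inter_open_nonempty _ hopen ⟨diracProba p₀, by
    change ∫ x, D x ∂(Measure.dirac p₀) < M⁻¹
    rw [integral_dirac' _ _ D.continuous.measurable.stronglyMeasurable, hD0]
    positivity⟩
  replace hμ : ∫ x, D x ∂(μ : Measure G.Space) < M⁻¹ := hμ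
  refine lt_of_lt_of_le (b := (M : EReal)) ?_ (le_iSup₂_of_le μ hμS (G.le_eigenvalue hk hD ?_))
  · exact EReal.coe_lt_coe_iff.2 (by linarith [le_abs_self N])
  · rwa [mul_comm, ← lt_div_iff₀ hM, one_div]
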